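/- Write $e(\theta)=\exp(2\pi i\theta)$ for real $\theta$, and let $\mathbb{T}$ be the unit circle in $\mathbb{C}$. For $d\ge 1$ let $c_{jk}$ be the integers with $x^k\equiv\sum_{j=0}^{\phi(d)-1}c_{jk}x^j \pmod{\Phi_d(x)}$, where $\Phi_d$ is the $d$th cyclotomic polynomial, and define $g_d:\mathbb{T}^{\phi(d)}\to\mathbb{C}$ by \[ g_d(z_1,\ldots,z_{\phi(d)})=\sum_{k=0}^{d-1}\prod_{j=0}^{\phi(d)-1}z_{j+1}^{c_{jk}}. \] Let $r$ be an odd prime (so $\phi(r)=r-1$). Let $H_r$ be the region bounded by the $r$-cusped hypocycloid $\theta\mapsto(r-1)e(\theta)+e((1-r)\theta)$, $\theta\in\mathbb{R}$, that is, the union of this curve and all bounded connected components of its complement in $\mathbb{C}$. Then: \begin{enumerate} \item for all $z_1,\ldots,z_{r-1}\in\mathbb{T}$, \[ g_r(z_1,\ldots,z_{r-1})=z_1+\cdots+z_{r-1}+\frac{1}{z_1z_2\cdots z_{r-1}}; \] \item $H_r$ is compact, and its topological boundary is exactly the hypocycloid; \item the image of $g_r$ is exactly $H_r$; \item the set of traces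 of matrices in $SU(r)$ (the $r\times r$ complex unitary matrices of determinant $1$) is exactly $H_r$. \end{enumerate} -/

import Mathlib

/-- `e(θ) = exp(2πiθ)` for real `θ`. -/
noncomputable def expTwoPi (θ : ℝ) : ℂ :=
  Complex.exp (2 * (Real.pi : ℂ) * Complex.I * (θ : ℂ))

/-- The integer `c_{jk}` in `x^k ≡ ∑_{j < φ(d)} c_{jk} x^j (mod Φ_d(x))`: the coefficient of `x^j`
in the remainder of `x^k` upon division by the (monic) cyclotomic polynomial `Φ_d`. -/
noncomputable def cyclotomicCoeff (d j k : ℕ) : ℤ :=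
  ((Polynomial.X ^ k : Polynomial ℤ) %ₘ Polynomial.cyclotomic d ℤ).coeff j

/-- The Laurent polynomial function `g_d : 𝕋^{φ(d)} → ℂ`,
`g_d(z) = ∑_{k=0}^{d-1} ∏_{j=0}^{φ(d)-1} z_{j+1}^{c_{jk}}`. The variables are indexed from `0`. -/
noncomputable def gFun (d : ℕ) (z : Fin (Nat.totient d) → Circle) : ℂ :=
  ∑ k ∈ Finset.range d, ∏ j : Fin (Nat.totient d), (z j : ℂ) ^ cyclotomicCoeff d j k

/-- The curve `θ ↦ (r-1) e(θ) + e((1-r)θ)`, a hypocycloid with `r` cusps (one of them at `r`). -/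
noncomputable def hypocycloid (r : ℕ) (θ : ℝ) : ℂ :=
  ((r : ℂ) - 1) * expTwoPi θ + expTwoPi ((1 - (r : ℝ)) * θ)

/-- The region bounded by a planar curve with trace `C`: `C` together with all the bounded connected
components of its complement. -/
def regionBoundedBy (C : Set ℂ) : Set ℂ :=
  C ∪ {w | w ∉ C ∧ Bornology.IsBounded (connectedComponentIn Cᶜ w)}

/-- `H_r`, the region bounded by the `r`-cusped hypocycloid. -/
noncomputable def hypocycloidRegion (r : ℕ) : Set ℂ :=
  regionBoundedBy (Set.range (hypocycloid r))

/-!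
All four claims are about one set: let `T = unitSums r` be the set of sums of `r` complex numbers of
modulus one with product one. The reduction of `x ^ (r - 1)` modulo `1 + x + ⋯ + x ^ (r - 1)` gives
the formula for `g_r`, whose image is therefore `T` (`range_gFun`). The eigenvalues of a matrix in
`SU(r)`, and the entries of a diagonal one, show that the traces also form `T`
(`traces_specialUnitaryGroup`). What remains is that `T` is the region bounded by the hypocycloid
`C`, and that `C` is its frontier.

* `C ⊆ T`, the points of `C` being those with `r - 1` equal summands; `T` is compact; `0 ∈ T`.
* Every point of `T` off `C` is interior to `T` (`unitSums_mem_nhds`). If three of the summands are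
  distinct, rotating them with total angle zero moves the sum over a neighbourhood, by the inverse
  function theorem: three distinct points of a circle are not collinear. Otherwise the summands take
  two values `z ≠ w`, each at least twice, since the sum is not on `C`. Then `z, z, w, w` can be
  replaced by four unit numbers with the same sum and product, three of them distinct
  (`exists_three_distinct_of_two_pairs`).
* `C` avoids `0` and meets each ray from `0` at most once (`hypocycloid_eq_of_ray`), since the
  argument along the curve is strictly increasing and gains exactly `2π` per period.

The rest is plane topology. The frontier of `T` lies in `C`, so a ray from `0` meets it at most once.
Hence a ray that has left `T` does not come back, and the points outside `T` lie in unbounded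
components of the complement of `C`; the components that meet `T` stay inside the bounded set `T`.
And every point of `C` is on the frontier of `T`, for otherwise its ray would leave `T` later, at a
second point of `C`.
-/

open Filter Topology

/-! ### The sums of unit complex numbers with product one -/

/-- The set of sums of `n` complex numbers of modulus one whose product is one. The summands are
taken as a multiset, so that an eigenvalue list or a choice of some of the summands needs no
indexing. -/
def unitSums (n : ℕ) : Set ℂ :=
  {w | ∃ m : Multiset ℂ, m.card = n ∧ (∀ z ∈ m, ‖z‖ = 1) ∧ m.prod = 1 ∧ m.sum = w}

/-! ### The Laurent polynomial of a prime -/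

theorem cyclotomicCoeff_of_lt {r k : ℕ} (hk : k < r.totient) (j : ℕ) :
    cyclotomicCoeff r j k = if j = k then 1 else 0 := by
  unfold cyclotomicCoeff
  rw [(Polynomial.modByMonic_eq_self_iff (Polynomial.cyclotomic.monic r ℤ)).2,
    Polynomial.coeff_X_pow]
  rw [Polynomial.degree_X_pow, Polynomial.degree_cyclotomic]
  exact_mod_cast hk

theorem cyclotomicCoeff_prime_totient {r : ℕ} (hr : r.Prime) {j : ℕ} (hj : j < r.totient) :
    cyclotomicCoeff r j r.totient = -1 := by
  have hr1 : r = r.totient + 1 := by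
    rw [Nat.totient_prime hr, Nat.sub_add_cancel hr.one_le]
  have := Fact.mk hr
  have hcyc : Polynomial.cyclotomic r ℤ =
      ∑ i ∈ Finset.range r.totient, Polynomial.X ^ i + Polynomial.X ^ r.totient := by
    rw [Polynomial.cyclotomic_prime, ← Finset.sum_range_succ, ← hr1]
  have hmod : (Polynomial.X ^ r.totient : Polynomial ℤ) %ₘ Polynomial.cyclotomic r ℤ =
      -∑ i ∈ Finset.range r.totient, Polynomial.X ^ i := by
    refine (Polynomial.div_modByMonic_unique 1 _ (Polynomial.cyclotomic.monic r ℤ) ⟨?_, ?_⟩).2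
    · rw [hcyc]; ring
    · rw [Polynomial.degree_neg, Polynomial.degree_cyclotomic]
      refine (Polynomial.degree_sum_le _ _).trans_lt ?_
      rw [Finset.sup_lt_iff (by exact WithBot.bot_lt_coe _)]
      intro i hi
      rw [Polynomial.degree_X_pow]
      exact_mod_cast Finset.mem_range.1 hi
  unfold cyclotomicCoeff
  rw [hmod]
  simp [Polynomial.finsetSum_coeff, Polynomial.coeff_X_pow, hj]

theorem gFun_prime {r : ℕ} (hr : r.Prime) (z : Fin r.totient → Circle) :
    gFun r z = (∑ j, (z j : ℂ)) + 1 / ∏ j, (z j : ℂ) := by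
  have hr1 : r = r.totient + 1 := by
    rw [Nat.totient_prime hr, Nat.sub_add_cancel hr.one_le]
  have hrange : Finset.range r = Finset.range (r.totient + 1) := by rw [← hr1]
  unfold gFun
  rw [hrange, Finset.sum_range_succ, Finset.sum_range]
  congr 1
  · refine Finset.sum_congr rfl fun k _ => ?_
    rw [Finset.prod_eq_single k]
    · simp [cyclotomicCoeff_of_lt k.2]
    · intro j _ hjk
      rw [cyclotomicCoeff_of_lt k.2, if_neg (by simpa [Fin.ext_iff] using hjk), zpow_zero]
    · simp
  · rw [one_div, ← Finset.prod_inv_distrib]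
    refine Finset.prod_congr rfl fun j _ => ?_
    rw [cyclotomicCoeff_prime_totient hr j.2, zpow_neg_one]

/-- Choosing `n` of the summands freely on the circle determines the last one. -/
theorem range_sum_add_inv_prod (n : ℕ) :
    Set.range (fun z : Fin n → Circle => (∑ j, (z j : ℂ)) + 1 / ∏ j, (z j : ℂ)) =
      unitSums (n + 1) := by
  ext w
  constructor
  · rintro ⟨z, rfl⟩
    have hne : ∏ j, (z j : ℂ) ≠ 0 := Finset.prod_ne_zero_iff.2 fun j _ => Circle.coe_ne_zero _
    refine ⟨(1 / ∏ j, (z j : ℂ)) ::ₘ Finset.univ.val.map (fun j => (z j : ℂ)), ?_, ?_, ?_, ?_⟩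
    · simp
    · intro a ha
      rw [Multiset.mem_cons, Multiset.mem_map] at ha
      rcases ha with rfl | ⟨j, -, rfl⟩
      · simp [Circle.norm_coe]
      · exact Circle.norm_coe (z j)
    · rw [Multiset.prod_cons]
      exact one_div_mul_cancel hne
    · rw [Multiset.sum_cons, add_comm]
      rfl
  · rintro ⟨m, hcard, hnorm, hprod, rfl⟩
    obtain ⟨a, m, rfl⟩ : ∃ a m', m = a ::ₘ m' := by
      obtain ⟨a, ha⟩ := Multiset.card_pos_iff_exists_mem.1 (by omega : 0 < m.card)
      exact ⟨a, Multiset.exists_cons_of_mem ha⟩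
    induction m using Quot.inductionOn with
    | h l =>
      have hl : l.length = n := by simpa using hcard
      subst hl
      refine ⟨fun j => ⟨l.get j, mem_sphere_zero_iff_norm.2 (hnorm _ ?_)⟩, ?_⟩
      · exact Multiset.mem_cons_of_mem (List.get_mem l j)
      · have h1 : ∏ j, l.get j = l.prod := by
          rw [← List.prod_ofFn, List.ofFn_get]
        have h2 : ∑ j, l.get j = l.sum := by
          rw [← List.sum_ofFn, List.ofFn_get]
        have h3 : a * l.prod = 1 := by simpa using hprod
        have h4 : (a ::ₘ (Quot.mk _ l : Multiset ℂ)).sum = a + l.sum := by simp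
        rw [h4]
        change (∑ j, l.get j) + 1 / ∏ j, l.get j = _
        rw [h1, h2, ← eq_one_div_of_mul_eq_one_left h3, add_comm]

theorem range_gFun {r : ℕ} (hr : r.Prime) : Set.range (gFun r) = unitSums r := by
  have hr1 : r.totient + 1 = r := by
    rw [Nat.totient_prime hr, Nat.sub_add_cancel hr.one_le]
  conv_rhs => rw [← hr1]
  rw [← range_sum_add_inv_prod]
  exact congrArg Set.range (funext (gFun_prime hr))

theorem isCompact_unitSums_succ (n : ℕ) : IsCompact (unitSums (n + 1)) := by
  rw [← range_sum_add_inv_prod]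
  refine isCompact_range ?_
  refine Continuous.add (by fun_prop) (Continuous.div continuous_const (by fun_prop) ?_)
  exact fun z => Finset.prod_ne_zero_iff.2 fun j _ => Circle.coe_ne_zero _

/-! ### Traces of special unitary matrices -/

open scoped Matrix.Norms.L2Operator in
theorem norm_eq_one_of_mem_roots_charpoly {n : ℕ} {A : Matrix (Fin n) (Fin n) ℂ}
    (hA : A ∈ Matrix.unitaryGroup (Fin n) ℂ) {z : ℂ} (hz : z ∈ A.charpoly.roots) : ‖z‖ = 1 := by
  have hmem : z ∈ spectrum ℂ A := Matrix.mem_spectrum_iff_isRoot_charpoly.2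
    (Polynomial.isRoot_of_mem_roots hz)
  exact mem_sphere_zero_iff_norm.1 (spectrum.subset_circle_of_unitary hA hmem)

theorem traces_specialUnitaryGroup (n : ℕ) :
    {w : ℂ | ∃ A ∈ Matrix.specialUnitaryGroup (Fin n) ℂ, A.trace = w} = unitSums n := by
  ext w
  constructor
  · rintro ⟨A, hA, rfl⟩
    rw [Matrix.mem_specialUnitaryGroup_iff] at hA
    refine ⟨A.charpoly.roots, ?_, fun z hz => norm_eq_one_of_mem_roots_charpoly hA.1 hz, ?_, ?_⟩
    · rw [IsAlgClosed.card_roots_eq_natDegree, Matrix.charpoly_natDegree_eq_dim, Fintype.card_fin]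
    · rw [← Matrix.det_eq_prod_roots_charpoly, hA.2]
    · rw [← Matrix.trace_eq_sum_roots_charpoly]
  · rintro ⟨m, hcard, hnorm, hprod, rfl⟩
    induction m using Quot.inductionOn with
    | h l =>
      have hl : l.length = n := by simpa using hcard
      subst hl
      refine ⟨Matrix.diagonal l.get, ?_, ?_⟩
      · rw [Matrix.mem_specialUnitaryGroup_iff, Matrix.mem_unitaryGroup_iff]
        constructor
        · rw [Matrix.star_eq_conjTranspose, Matrix.diagonal_conjTranspose,
            Matrix.diagonal_mul_diagonal, ← Matrix.diagonal_one]
          congr 1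
          ext j
          have hj : ‖l.get j‖ = 1 := hnorm _ (List.get_mem l j)
          change l.get j * (starRingEnd ℂ) (l.get j) = 1
          rw [Complex.mul_conj', hj]
          simp
        · rw [Matrix.det_diagonal, ← List.prod_ofFn, List.ofFn_get]
          simpa using hprod
      · rw [Matrix.trace_diagonal, ← List.sum_ofFn, List.ofFn_get]
        simp

/-! ### Interior points -/

/-- A nonempty multiset has three distinct elements, or two distinct elements each of multiplicity
at least two, or all of its elements but one equal. -/
theorem multiset_trichotomy {α : Type*} (m : Multiset α) (hm : m ≠ 0) :
    (∃ a b c m', a ≠ b ∧ b ≠ c ∧ a ≠ c ∧ m = a ::ₘ b ::ₘ c ::ₘ m') ∨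
    (∃ a b m', a ≠ b ∧ m = a ::ₘ a ::ₘ b ::ₘ b ::ₘ m') ∨
    ∃ a b k, m = a ::ₘ Multiset.replicate k b := by
  induction m using Multiset.induction_on with
  | empty => exact absurd rfl hm
  | cons x m ih =>
    by_cases hm0 : m = 0
    · subst hm0
      exact Or.inr (Or.inr ⟨x, x, 0, rfl⟩)
    rcases ih hm0 with ⟨a, b, c, m', hab, hbc, hac, rfl⟩ | ⟨a, b, m', hab, rfl⟩ | ⟨a, b, k, rfl⟩
    · refine Or.inl ⟨a, b, c, x ::ₘ m', hab, hbc, hac, ?_⟩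
      simp only [Multiset.cons_swap x]
    · refine Or.inr (Or.inl ⟨a, b, x ::ₘ m', hab, ?_⟩)
      simp only [Multiset.cons_swap x]
    · rcases k with _ | k
      · exact Or.inr (Or.inr ⟨x, a, 1, rfl⟩)
      by_cases hab : a = b
      · subst hab
        exact Or.inr (Or.inr ⟨x, a, k + 2, by simp [Multiset.replicate_succ]⟩)
      by_cases hxb : x = b
      · subst hxb
        exact Or.inr (Or.inr ⟨a, x, k + 2, by
          rw [Multiset.cons_swap, ← Multiset.replicate_succ]⟩)
      by_cases hxa : x = a
      · subst hxa
        rcases k with _ | k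
        · refine Or.inr (Or.inr ⟨b, x, 2, ?_⟩)
          rw [zero_add, Multiset.replicate_one, Multiset.replicate_succ, Multiset.replicate_one]
          change x ::ₘ x ::ₘ b ::ₘ 0 = b ::ₘ x ::ₘ x ::ₘ 0
          rw [Multiset.cons_swap x b, Multiset.cons_swap x b]
        · exact Or.inr (Or.inl ⟨x, b, Multiset.replicate k b, hab, by
            simp [Multiset.replicate_succ]⟩)
      · exact Or.inl ⟨x, a, b, Multiset.replicate k b, hxa, hab, hxb, by
          rw [Multiset.replicate_succ]⟩

/-- Three distinct points of the unit circle are not collinear. -/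
theorem im_sub_mul_conj_sub_ne_zero {a b c : ℂ} (ha : ‖a‖ = 1) (hb : ‖b‖ = 1) (hc : ‖c‖ = 1)
    (hab : a ≠ b) (hbc : b ≠ c) (hac : a ≠ c) :
    ((a - c) * (starRingEnd ℂ) (b - c)).im ≠ 0 := by
  intro h
  have ha0 : a ≠ 0 := by rintro rfl; simp at ha
  have hb0 : b ≠ 0 := by rintro rfl; simp at hb
  have hc0 : c ≠ 0 := by rintro rfl; simp at hc
  have h1 := Complex.conj_eq_iff_im.2 h
  rw [map_mul, Complex.conj_conj, map_sub, map_sub, ← Complex.inv_eq_conj ha,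
    ← Complex.inv_eq_conj hb, ← Complex.inv_eq_conj hc] at h1
  field_simp at h1
  have h2 : (a - b) * ((b - c) * (a - c)) = 0 := by linear_combination h1
  simp [sub_eq_zero, hab, hbc, hac] at h2

/-- Two complex numbers that are not real multiples of each other span `ℂ` over `ℝ`. -/
theorem exists_real_combination {u v : ℂ} (h : (u * (starRingEnd ℂ) v).im ≠ 0) (w : ℂ) :
    ∃ s t : ℝ, (s : ℂ) * u + t * v = w := by
  refine ⟨(w * (starRingEnd ℂ) v).im / (u * (starRingEnd ℂ) v).im,
    (u * (starRingEnd ℂ) w).im / (u * (starRingEnd ℂ) v).im, ?_⟩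
  have h0 : (((u * (starRingEnd ℂ) v).im : ℝ) : ℂ) ≠ 0 := by exact_mod_cast h
  rw [Complex.ofReal_div, Complex.ofReal_div, div_mul_eq_mul_div, div_mul_eq_mul_div, ← add_div,
    div_eq_iff h0]
  apply Complex.ext <;> simp <;> ring

/-- Rotating three distinct unit numbers by angles of sum zero moves their sum over a neighbourhood
of its initial value. -/
theorem range_three_rotations_mem_nhds {a b c : ℂ} (ha : ‖a‖ = 1) (hb : ‖b‖ = 1) (hc : ‖c‖ = 1)
    (hab : a ≠ b) (hbc : b ≠ c) (hac : a ≠ c) (q : ℂ) :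
    Set.range (fun x : ℝ × ℝ => a * Complex.exp (x.1 * Complex.I) +
      (b * Complex.exp (x.2 * Complex.I) + (c * Complex.exp (-(x.1 + x.2) * Complex.I) + q))) ∈
      𝓝 (a + (b + (c + q))) := by
  set f : ℝ × ℝ → ℂ := fun x => a * Complex.exp (x.1 * Complex.I) +
      (b * Complex.exp (x.2 * Complex.I) + (c * Complex.exp (-(x.1 + x.2) * Complex.I) + q))
    with hf
  have h1 : HasStrictFDerivAt (fun x : ℝ × ℝ => (x.1 : ℂ))
      (Complex.ofRealCLM.comp (ContinuousLinearMap.fst ℝ ℝ ℝ)) 0 :=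
    (Complex.ofRealCLM.comp (ContinuousLinearMap.fst ℝ ℝ ℝ)).hasStrictFDerivAt
  have h2 : HasStrictFDerivAt (fun x : ℝ × ℝ => (x.2 : ℂ))
      (Complex.ofRealCLM.comp (ContinuousLinearMap.snd ℝ ℝ ℝ)) 0 :=
    (Complex.ofRealCLM.comp (ContinuousLinearMap.snd ℝ ℝ ℝ)).hasStrictFDerivAt
  have hd := (((h1.mul_const Complex.I).cexp).const_mul a).add
    ((((h2.mul_const Complex.I).cexp).const_mul b).add
      (((((h1.add h2).neg.mul_const Complex.I).cexp).const_mul c).add_const q))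
  have hmap : map f (𝓝 0) = 𝓝 (f 0) := hd.map_nhds_eq_of_surj (by
    rw [LinearMap.range_eq_top]
    intro w
    obtain ⟨s, t, hst⟩ := exists_real_combination
      (im_sub_mul_conj_sub_ne_zero ha hb hc hab hbc hac) (-Complex.I * w)
    refine ⟨(s, t), ?_⟩
    have : w = Complex.I * (-Complex.I * w) := by
      rw [← mul_assoc, mul_neg, Complex.I_mul_I, neg_neg, one_mul]
    rw [this, ← hst]
    simp
    ring)
  have h0 : f 0 = a + (b + (c + q)) := by simp [hf]
  rw [← h0, ← hmap]
  exact range_mem_map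

theorem unitSums_mem_nhds_of_three_distinct {n : ℕ} {a b c : ℂ} {m : Multiset ℂ}
    (hab : a ≠ b) (hbc : b ≠ c) (hac : a ≠ c) (hcard : (a ::ₘ b ::ₘ c ::ₘ m).card = n)
    (hnorm : ∀ z ∈ a ::ₘ b ::ₘ c ::ₘ m, ‖z‖ = 1) (hprod : (a ::ₘ b ::ₘ c ::ₘ m).prod = 1) :
    unitSums n ∈ 𝓝 (a ::ₘ b ::ₘ c ::ₘ m).sum := by
  simp only [Multiset.mem_cons, forall_eq_or_imp, Multiset.prod_cons] at hnorm hprod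
  obtain ⟨ha, hb, hc, hm⟩ := hnorm
  simp only [Multiset.sum_cons]
  refine mem_of_superset (range_three_rotations_mem_nhds ha hb hc hab hbc hac m.sum) ?_
  rintro _ ⟨⟨s, t⟩, rfl⟩
  have hexp : Complex.exp (s * Complex.I) * (Complex.exp (t * Complex.I) *
      Complex.exp (-(s + t) * Complex.I)) = 1 := by
    rw [← Complex.exp_add, ← Complex.exp_add, ← Complex.exp_zero]
    congr 1
    ring
  have hn : ‖Complex.exp (-(s + t) * Complex.I)‖ = 1 := by
    have := Complex.norm_exp_ofReal_mul_I (-(s + t))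
    push_cast at this
    exact this
  refine ⟨(a * Complex.exp (s * Complex.I)) ::ₘ (b * Complex.exp (t * Complex.I)) ::ₘ
    (c * Complex.exp (-(s + t) * Complex.I)) ::ₘ m, by simpa using hcard, ?_, ?_, ?_⟩
  · simp only [Multiset.mem_cons, forall_eq_or_imp, norm_mul, ha, hb, hc, hn,
      Complex.norm_exp_ofReal_mul_I, mul_one, true_and]
    exact hm
  · simp only [Multiset.prod_cons]
    linear_combination hprod + a * b * c * m.prod * hexp
  · simp only [Multiset.sum_cons]

theorem exists_unit_of_re {x : ℝ} (h : |x| < 1) : ∃ v : ℂ, ‖v‖ = 1 ∧ v.re = x ∧ 0 < v.im := by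
  have hx : 0 < 1 - x ^ 2 := by
    have := (sq_lt_one_iff_abs_lt_one x).2 h
    linarith
  refine ⟨⟨x, √(1 - x ^ 2)⟩, ?_, rfl, Real.sqrt_pos.2 hx⟩
  rw [Complex.norm_def, Complex.normSq_mk, Real.mul_self_sqrt hx.le, Real.sqrt_eq_one]
  ring

/-- In the coordinate where `z * w = 1`, the four numbers are `v, v, v̄, v̄`, with sum `4 * v.re`.
Changing the real part of one conjugate pair by `ε` and that of the other by `-ε` preserves the sum
and the product. -/
theorem exists_three_distinct_of_two_pairs {z w : ℂ} (hz : ‖z‖ = 1) (hw : ‖w‖ = 1) (hzw : z ≠ w) :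
    ∃ a b c d : ℂ, ‖a‖ = 1 ∧ ‖b‖ = 1 ∧ ‖c‖ = 1 ∧ ‖d‖ = 1 ∧ a ≠ b ∧ b ≠ c ∧ a ≠ c ∧
      a * (b * (c * d)) = z * (z * (w * w)) ∧ a + (b + (c + d)) = z + (z + (w + w)) := by
  have hz0 : z ≠ 0 := by rintro rfl; simp at hz
  -- Rotate by a square root `u` of `z * w`, so that `z = u * v` and `w = u * conj v`.
  obtain ⟨u, hu⟩ := IsAlgClosed.exists_pow_nat_eq (z * w) (n := 2) (by norm_num)
  have hu1 : ‖u‖ = 1 := by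
    have : ‖u‖ ^ 2 = 1 := by rw [← norm_pow, hu, norm_mul, hz, hw, one_mul]
    exact (pow_eq_one_iff_of_nonneg (norm_nonneg u) two_ne_zero).1 this
  have hu0 : u ≠ 0 := by rintro rfl; simp at hu1
  obtain ⟨v, rfl⟩ : ∃ v, z = u * v := ⟨z / u, by field_simp⟩
  have hv : ‖v‖ = 1 := by rwa [norm_mul, hu1, one_mul] at hz
  have hw' : w = u * (starRingEnd ℂ) v := by
    have hv0 : v ≠ 0 := by rintro rfl; simp at hv
    rw [← Complex.inv_eq_conj hv]
    field_simp
    apply mul_left_cancel₀ hu0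
    linear_combination -hu
  subst hw'
  have hvi : v.im ≠ 0 := fun h => hzw (by rw [Complex.conj_eq_iff_im.2 h])
  have hre : |v.re| < 1 := by
    rw [← hv]
    exact Complex.abs_re_lt_norm.2 hvi
  obtain ⟨ε, hε, h1, h2⟩ : ∃ ε : ℝ, 0 < ε ∧ |v.re + ε| < 1 ∧ |v.re - ε| < 1 := by
    refine ⟨(1 - |v.re|) / 2, by linarith, ?_, ?_⟩ <;>
    · have := abs_lt.1 hre
      rw [abs_lt]
      rcases abs_cases v.re with h | h <;> constructor <;> linarith
  obtain ⟨v₁, hn₁, hr₁, hi₁⟩ := exists_unit_of_re h1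
  obtain ⟨v₂, hn₂, hr₂, hi₂⟩ := exists_unit_of_re h2
  have hc : ∀ x : ℂ, ‖x‖ = 1 → x * (starRingEnd ℂ) x = 1 := fun x hx => by
    rw [Complex.mul_conj', hx]; simp
  refine ⟨u * v₁, u * (starRingEnd ℂ) v₁, u * v₂, u * (starRingEnd ℂ) v₂, ?_, ?_, ?_, ?_, ?_, ?_,
    ?_, ?_, ?_⟩
  · rw [norm_mul, hu1, hn₁, one_mul]
  · rw [norm_mul, RCLike.norm_conj, hu1, hn₁, one_mul]
  · rw [norm_mul, hu1, hn₂, one_mul]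
  · rw [norm_mul, RCLike.norm_conj, hu1, hn₂, one_mul]
  · intro h
    have := congrArg Complex.im (mul_left_cancel₀ hu0 h)
    rw [Complex.conj_im] at this
    linarith
  · intro h
    have := congrArg Complex.re (mul_left_cancel₀ hu0 h)
    rw [Complex.conj_re] at this
    linarith
  · intro h
    have := congrArg Complex.re (mul_left_cancel₀ hu0 h)
    linarith
  · linear_combination u ^ 4 * (v₂ * (starRingEnd ℂ) v₂) * hc v₁ hn₁ + u ^ 4 * hc v₂ hn₂ -
      u ^ 4 * (v * (starRingEnd ℂ) v) * hc v hv - u ^ 4 * hc v hv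
  · have h₁ := Complex.add_conj v₁
    have h₂ := Complex.add_conj v₂
    have h₃ := Complex.add_conj v
    rw [hr₁] at h₁
    rw [hr₂] at h₂
    push_cast at h₁ h₂ h₃
    linear_combination u * h₁ + u * h₂ - 2 * u * h₃

/-! ### Points with all summands but one equal -/

theorem expTwoPi_add (x y : ℝ) : expTwoPi (x + y) = expTwoPi x * expTwoPi y := by
  unfold expTwoPi
  rw [← Complex.exp_add]
  push_cast
  ring_nf

theorem expTwoPi_natCast_mul (n : ℕ) (x : ℝ) : expTwoPi (n * x) = expTwoPi x ^ n := by
  unfold expTwoPi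
  rw [← Complex.exp_nat_mul]
  push_cast
  ring_nf

theorem expTwoPi_eq (x : ℝ) : expTwoPi x = Complex.exp ((2 * Real.pi * x : ℝ) * Complex.I) := by
  unfold expTwoPi
  push_cast
  ring_nf

theorem norm_expTwoPi (x : ℝ) : ‖expTwoPi x‖ = 1 := by
  rw [expTwoPi_eq, Complex.norm_exp_ofReal_mul_I]

theorem exists_expTwoPi_eq {z : ℂ} (hz : ‖z‖ = 1) : ∃ θ : ℝ, expTwoPi θ = z := by
  refine ⟨z.arg / (2 * Real.pi), ?_⟩
  rw [expTwoPi_eq, mul_div_cancel₀ _ (by positivity)]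
  have := Complex.norm_mul_exp_arg_mul_I z
  rwa [hz, Complex.ofReal_one, one_mul] at this

/-- The `n + 1` summands of a point of the hypocycloid have product one. -/
theorem expTwoPi_pow_mul (n : ℕ) (θ : ℝ) :
    expTwoPi ((1 - ((n + 1 : ℕ) : ℝ)) * θ) * expTwoPi θ ^ n = 1 := by
  rw [← expTwoPi_natCast_mul, ← expTwoPi_add]
  push_cast
  have : (1 - ((n : ℝ) + 1)) * θ + n * θ = 0 := by ring
  rw [this]
  simp [expTwoPi]

theorem hypocycloid_mem_unitSums (n : ℕ) (θ : ℝ) :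
    hypocycloid (n + 1) θ ∈ unitSums (n + 1) := by
  refine ⟨expTwoPi ((1 - ((n + 1 : ℕ) : ℝ)) * θ) ::ₘ Multiset.replicate n (expTwoPi θ),
    by simp, ?_, ?_, ?_⟩
  · simp only [Multiset.mem_cons, forall_eq_or_imp, norm_expTwoPi, true_and]
    intro z hz
    rw [Multiset.eq_of_mem_replicate hz, norm_expTwoPi]
  · rw [Multiset.prod_cons, Multiset.prod_replicate, expTwoPi_pow_mul]
  · rw [Multiset.sum_cons, Multiset.sum_replicate, hypocycloid, nsmul_eq_mul]
    push_cast
    ring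

/-- Every point of the set that is not on the hypocycloid is an interior point. -/
theorem unitSums_mem_nhds {n : ℕ} {w : ℂ} (hw : w ∈ unitSums (n + 1))
    (hC : w ∉ Set.range (hypocycloid (n + 1))) : unitSums (n + 1) ∈ 𝓝 w := by
  obtain ⟨m, hcard, hnorm, hprod, rfl⟩ := hw
  have hm : m ≠ 0 := by rintro rfl; simp at hcard
  rcases multiset_trichotomy m hm with ⟨a, b, c, m', hab, hbc, hac, rfl⟩ | ⟨a, b, m', hab, rfl⟩ |
    ⟨a, b, k, rfl⟩
  · exact unitSums_mem_nhds_of_three_distinct hab hbc hac hcard hnorm hprod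
  · simp only [Multiset.mem_cons, forall_eq_or_imp, Multiset.prod_cons] at hnorm hprod
    obtain ⟨ha, -, hb, -, hm'⟩ := hnorm
    obtain ⟨x, y, z, t, hx, hy, hz, ht, hxy, hyz, hxz, hp, hs⟩ :=
      exists_three_distinct_of_two_pairs ha hb hab
    have hsum : (a ::ₘ a ::ₘ b ::ₘ b ::ₘ m').sum = (x ::ₘ y ::ₘ z ::ₘ t ::ₘ m').sum := by
      simp only [Multiset.sum_cons]
      linear_combination -hs
    rw [hsum]
    refine unitSums_mem_nhds_of_three_distinct hxy hyz hxz (by simpa using hcard) ?_ ?_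
    · simp only [Multiset.mem_cons, forall_eq_or_imp]
      exact ⟨hx, hy, hz, ht, hm'⟩
    · simp only [Multiset.prod_cons]
      linear_combination hprod + m'.prod * hp
  -- The third case is the hypocycloid itself; for `k = 0` the only summand is `1`.
  · exfalso
    obtain rfl : k = n := by simpa using hcard
    by_cases hk : k = 0
    · subst hk
      apply hC
      have : a = 1 := by simpa using hprod
      refine ⟨0, ?_⟩
      simp [hypocycloid, expTwoPi, this]
    obtain ⟨θ, hθ⟩ := exists_expTwoPi_eq (hnorm b (by simp [Multiset.mem_replicate, hk]))
    refine hC ⟨θ, ?_⟩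
    rw [Multiset.prod_cons, Multiset.prod_replicate, ← hθ] at hprod
    have hb0 : expTwoPi θ ^ k ≠ 0 := pow_ne_zero _ (by simp [expTwoPi])
    have ha : a = expTwoPi ((1 - ((k + 1 : ℕ) : ℝ)) * θ) :=
      mul_right_cancel₀ hb0 (hprod.trans (expTwoPi_pow_mul k θ).symm)
    rw [Multiset.sum_cons, Multiset.sum_replicate, hypocycloid, nsmul_eq_mul, ha, hθ]
    push_cast
    ring

/-! ### The argument along the hypocycloid -/

/-- Polar form of a number in the right half plane. -/
theorem exists_pos_mul_exp_arctan {x : ℝ} (hx : 0 < x) (y : ℝ) :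
    ∃ ρ : ℝ, 0 < ρ ∧ (x : ℂ) + y * Complex.I =
      ρ * Complex.exp (Real.arctan (y / x) * Complex.I) := by
  have hs : 0 < √(1 + (y / x) ^ 2) := Real.sqrt_pos.2 (by positivity)
  refine ⟨x * √(1 + (y / x) ^ 2), by positivity, ?_⟩
  have hs' : ((√(1 + (y / x) ^ 2) : ℝ) : ℂ) ≠ 0 := by exact_mod_cast hs.ne'
  have hx' : (x : ℂ) ≠ 0 := by exact_mod_cast hx.ne'
  rw [Complex.exp_mul_I, ← Complex.ofReal_cos, ← Complex.ofReal_sin, Real.cos_arctan,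
    Real.sin_arctan]
  rw [Complex.ofReal_div, Complex.ofReal_div, Complex.ofReal_mul]
  generalize ((√(1 + (y / x) ^ 2) : ℝ) : ℂ) = s at hs'
  push_cast
  field_simp

/-- A continuous argument along the hypocycloid with `n + 1` cusps, read off from the factorisation
`n e(θ) + e(-nθ) = e(θ) (n + e(-(n + 1)θ))`, whose last factor lies in the right half plane for
`n ≥ 2`. -/
noncomputable def hypocycloidAngle (n : ℕ) (θ : ℝ) : ℝ :=
  2 * Real.pi * θ - Real.arctan (Real.sin (2 * Real.pi * (n + 1) * θ) /
    (n + Real.cos (2 * Real.pi * (n + 1) * θ)))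

theorem natCast_add_cos_pos {n : ℕ} (hn : 2 ≤ n) (x : ℝ) : 0 < (n : ℝ) + Real.cos x := by
  have : (2 : ℝ) ≤ n := by exact_mod_cast hn
  linarith [Real.neg_one_le_cos x]

theorem hypocycloid_eq_pos_mul_exp {n : ℕ} (hn : 2 ≤ n) (θ : ℝ) :
    ∃ ρ : ℝ, 0 < ρ ∧
      hypocycloid (n + 1) θ = ρ * Complex.exp (hypocycloidAngle n θ * Complex.I) := by
  set φ : ℝ := 2 * Real.pi * (n + 1) * θ with hφ
  obtain ⟨ρ, hρ, h⟩ := exists_pos_mul_exp_arctan (natCast_add_cos_pos hn φ) (-Real.sin φ)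
  refine ⟨ρ, hρ, ?_⟩
  have h1 : hypocycloid (n + 1) θ = expTwoPi θ * (n + Complex.exp ((-φ : ℝ) * Complex.I)) := by
    have : (1 - ((n + 1 : ℕ) : ℝ)) * θ = θ + -((n + 1) * θ) := by push_cast; ring
    rw [hypocycloid, this, expTwoPi_add, expTwoPi_eq (-_)]
    have h2 : 2 * Real.pi * -((n + 1) * θ) = -φ := by rw [hφ]; ring
    rw [h2]
    push_cast
    ring
  have h2 : (n : ℂ) + Complex.exp ((-φ : ℝ) * Complex.I) =
      ((n + Real.cos φ : ℝ) : ℂ) + (-Real.sin φ : ℝ) * Complex.I := by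
    rw [Complex.exp_mul_I, ← Complex.ofReal_cos, ← Complex.ofReal_sin, Real.cos_neg, Real.sin_neg]
    push_cast
    ring
  rw [h1, h2, h, expTwoPi_eq, mul_left_comm, ← Complex.exp_add, hypocycloidAngle, ← hφ, neg_div,
    Real.arctan_neg]
  push_cast
  ring_nf

theorem hasDerivAt_hypocycloidAngle {n : ℕ} (hn : 2 ≤ n) (θ : ℝ) :
    HasDerivAt (hypocycloidAngle n) (2 * Real.pi * (n * (n - 1)) *
      (1 - Real.cos (2 * Real.pi * (n + 1) * θ)) /
        (n ^ 2 + 2 * n * Real.cos (2 * Real.pi * (n + 1) * θ) + 1)) θ := by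
  have hlin : HasDerivAt (fun θ : ℝ => 2 * Real.pi * (n + 1) * θ) (2 * Real.pi * (n + 1)) θ := by
    simpa using (hasDerivAt_id θ).const_mul (2 * Real.pi * (n + 1))
  have hlin' : HasDerivAt (fun θ : ℝ => 2 * Real.pi * θ) (2 * Real.pi) θ := by
    simpa using (hasDerivAt_id θ).const_mul (2 * Real.pi)
  have hpos := natCast_add_cos_pos hn (2 * Real.pi * (n + 1) * θ)
  have hd := hlin'.sub ((hlin.sin.div (hlin.cos.const_add (n : ℝ)) hpos.ne').arctan)
  refine hd.congr_deriv ?_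
  simp only [Pi.div_apply]
  have hsq := Real.sin_sq_add_cos_sq (2 * Real.pi * (n + 1) * θ)
  set s := Real.sin (2 * Real.pi * (n + 1) * θ)
  set c := Real.cos (2 * Real.pi * (n + 1) * θ)
  -- The denominator is the squared modulus of `n + e(-(n + 1)θ)`.
  have hD : (n : ℝ) ^ 2 + 2 * n * c + 1 = (n + c) ^ 2 + s ^ 2 := by linear_combination -hsq
  have hD0 : (n + c) ^ 2 + s ^ 2 ≠ 0 := by positivity
  rw [hD]
  have h1 : 1 + (s / (n + c)) ^ 2 = ((n + c) ^ 2 + s ^ 2) / (n + c) ^ 2 := by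
    field_simp
  rw [h1]
  field_simp
  linear_combination -(n : ℝ) * hsq

/-- The argument along the hypocycloid is stationary only at the cusps. -/
theorem hypocycloidAngle_deriv_nonneg {n : ℕ} (hn : 2 ≤ n) (θ : ℝ) :
    0 ≤ deriv (hypocycloidAngle n) θ ∧ (deriv (hypocycloidAngle n) θ = 0 →
      Real.cos (2 * Real.pi * (n + 1) * θ) = 1) := by
  rw [(hasDerivAt_hypocycloidAngle hn θ).deriv]
  have hn' : (2 : ℝ) ≤ n := by exact_mod_cast hn
  have hc := Real.neg_one_le_cos (2 * Real.pi * (n + 1) * θ)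
  have hc' := Real.cos_le_one (2 * Real.pi * (n + 1) * θ)
  generalize Real.cos (2 * Real.pi * (n + 1) * θ) = c at *
  have hD : 0 < (n : ℝ) ^ 2 + 2 * n * c + 1 := by nlinarith
  have hk : 0 < 2 * Real.pi * (n * ((n : ℝ) - 1)) := by
    have : 0 < (n : ℝ) - 1 := by linarith
    positivity
  constructor
  · exact div_nonneg (mul_nonneg hk.le (by linarith)) hD.le
  · intro h
    rw [div_eq_zero_iff, or_iff_left hD.ne', mul_eq_zero, or_iff_right hk.ne'] at h
    linarith

theorem strictMono_hypocycloidAngle {n : ℕ} (hn : 2 ≤ n) : StrictMono (hypocycloidAngle n) := by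
  have hmono : Monotone (hypocycloidAngle n) := monotone_of_deriv_nonneg
    (fun θ => (hasDerivAt_hypocycloidAngle hn θ).differentiableAt)
    fun θ => (hypocycloidAngle_deriv_nonneg hn θ).1
  intro a b hab
  refine lt_of_le_of_ne (hmono hab.le) fun hEq => ?_
  -- Otherwise the angle is constant on `[a, b]`, so the cosine below is `1` on `(a, b)`; comparing
  -- the midpoint with a point less than a period away gives a contradiction.
  have hcos : ∀ θ ∈ Set.Ioo a b, Real.cos (2 * Real.pi * (n + 1) * θ) = 1 := by
    intro θ hθ
    refine (hypocycloidAngle_deriv_nonneg hn θ).2 ?_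
    have : hypocycloidAngle n =ᶠ[𝓝 θ] fun _ => hypocycloidAngle n a := by
      filter_upwards [isOpen_Ioo.mem_nhds hθ] with x hx
      exact le_antisymm ((hmono hx.2.le).trans hEq.ge) (hmono hx.1.le)
    rw [this.deriv_eq, deriv_const]
  have hK : 0 < 2 * Real.pi * ((n : ℝ) + 1) := by positivity
  set K := 2 * Real.pi * ((n : ℝ) + 1)
  obtain ⟨δ, hδ, hδb, hδπ⟩ : ∃ δ, 0 < δ ∧ δ < (b - a) / 2 ∧ K * δ < 2 * Real.pi := by
    refine ⟨min ((b - a) / 4) (1 / K), lt_min (by linarith) (by positivity), ?_, ?_⟩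
    · exact (min_le_left _ _).trans_lt (by linarith)
    · calc K * min ((b - a) / 4) (1 / K) ≤ K * (1 / K) := by gcongr; exact min_le_right _ _
        _ = 1 := by field_simp
        _ < 2 * Real.pi := by linarith [Real.pi_gt_three]
  have h1 := hcos ((a + b) / 2) ⟨by linarith, by linarith⟩
  have h2 := hcos ((a + b) / 2 + δ) ⟨by linarith, by linarith⟩
  have hs : Real.sin (K * ((a + b) / 2)) = 0 := Real.sin_eq_zero_iff_cos_eq.2 (Or.inl h1)
  rw [mul_add, Real.cos_add, h1, hs, one_mul, zero_mul, sub_zero] at h2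
  have hKδ : 0 < K * δ := by positivity
  exact hKδ.ne' ((Real.cos_eq_one_iff_of_lt_of_lt (by linarith) hδπ).1 h2)

theorem hypocycloidAngle_add_int (n : ℕ) (θ : ℝ) (k : ℤ) :
    hypocycloidAngle n (θ + k) = hypocycloidAngle n θ + k * (2 * Real.pi) := by
  have : 2 * Real.pi * ((n : ℝ) + 1) * (θ + k) =
      2 * Real.pi * (n + 1) * θ + (((n + 1) * k : ℤ) : ℝ) * (2 * Real.pi) := by
    push_cast
    ring
  rw [hypocycloidAngle, this, Real.sin_add_int_mul_two_pi, Real.cos_add_int_mul_two_pi,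
    hypocycloidAngle]
  ring

theorem expTwoPi_int (k : ℤ) : expTwoPi k = 1 := by
  rw [expTwoPi, Complex.exp_eq_one_iff]
  exact ⟨k, by push_cast; ring⟩

theorem hypocycloid_add_int (r : ℕ) (θ : ℝ) (k : ℤ) :
    hypocycloid r (θ + k) = hypocycloid r θ := by
  have : (1 - (r : ℝ)) * (θ + k) = (1 - r) * θ + (((1 - r) * k : ℤ) : ℝ) := by
    push_cast
    ring
  rw [hypocycloid, this, expTwoPi_add, expTwoPi_add, expTwoPi_int, expTwoPi_int, hypocycloid,
    mul_one, mul_one]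

theorem hypocycloid_ne_zero {n : ℕ} (hn : 2 ≤ n) (θ : ℝ) : hypocycloid (n + 1) θ ≠ 0 := by
  obtain ⟨ρ, hρ, h⟩ := hypocycloid_eq_pos_mul_exp hn θ
  rw [h]
  exact mul_ne_zero (by exact_mod_cast hρ.ne') (Complex.exp_ne_zero _)

/-- The hypocycloid meets each ray from the origin at most once. -/
theorem hypocycloid_eq_of_ray {n : ℕ} (hn : 2 ≤ n) {θ₁ θ₂ t : ℝ} (ht : 0 < t)
    (h : hypocycloid (n + 1) θ₁ = t * hypocycloid (n + 1) θ₂) :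
    hypocycloid (n + 1) θ₁ = hypocycloid (n + 1) θ₂ := by
  obtain ⟨ρ₁, hρ₁, h₁⟩ := hypocycloid_eq_pos_mul_exp hn θ₁
  obtain ⟨ρ₂, hρ₂, h₂⟩ := hypocycloid_eq_pos_mul_exp hn θ₂
  rw [h₁, h₂, ← mul_assoc, ← Complex.ofReal_mul] at h
  have hρ : ρ₁ = t * ρ₂ := by
    have := congrArg norm h
    rwa [norm_mul, norm_mul, Complex.norm_exp_ofReal_mul_I, Complex.norm_exp_ofReal_mul_I,
      mul_one, mul_one, Complex.norm_of_nonneg hρ₁.le, Complex.norm_of_nonneg (by positivity)]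
      at this
  rw [← hρ] at h
  have he := mul_left_cancel₀ (by exact_mod_cast hρ₁.ne') h
  obtain ⟨k, hk⟩ := Complex.exp_eq_exp_iff_exists_int.1 he
  have hk' : hypocycloidAngle n θ₁ = hypocycloidAngle n (θ₂ + k) := by
    rw [hypocycloidAngle_add_int]
    apply Complex.ofReal_injective
    apply mul_right_cancel₀ Complex.I_ne_zero
    rw [hk]
    push_cast
    ring
  rw [(strictMono_hypocycloidAngle hn).injective hk', hypocycloid_add_int]

/-! ### Regions whose frontier meets each ray once -/

theorem IsPreconnected.exists_mem_frontier {X : Type*} [TopologicalSpace X] {S T : Set X}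
    (hS : IsPreconnected S) {x y : X} (hx : x ∈ S) (hxT : x ∈ T) (hy : y ∈ S) (hyT : y ∉ T) :
    ∃ z ∈ S, z ∈ frontier T := by
  by_contra! hno
  have hx' : x ∈ interior T := by
    by_contra h
    exact hno x hx ⟨subset_closure hxT, h⟩
  have hy' : y ∈ (closure T)ᶜ := fun h => hno y hy ⟨h, fun h' => hyT (interior_subset h')⟩
  obtain ⟨z, -, hz, hz'⟩ := hS _ _ isOpen_interior isClosed_closure.isOpen_compl
    (fun z hz => or_iff_not_imp_right.2 fun h => by_contra fun h' => hno z hz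
      ⟨not_not.1 h, h'⟩) ⟨x, hx, hx'⟩ ⟨y, hy, hy'⟩
  exact hz' (subset_closure (interior_subset hz))

section Rays

variable {T C : Set ℂ}

/-- A segment of a line through the origin with exactly one endpoint in `T` crosses `C`. -/
theorem exists_mem_of_segment {x : ℂ} (hfr : frontier T ⊆ C) {s t : ℝ} (hst : s ≤ t)
    (hx : ((s : ℂ) * x ∈ T ∧ (t : ℂ) * x ∉ T) ∨ ((s : ℂ) * x ∉ T ∧ (t : ℂ) * x ∈ T)) :
    ∃ u ∈ Set.Icc s t, (u : ℂ) * x ∈ C := by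
  have hcont : Continuous fun u : ℝ => (u : ℂ) * x := by fun_prop
  have hpre : IsPreconnected ((fun u : ℝ => (u : ℂ) * x) '' Set.Icc s t) :=
    isPreconnected_Icc.image _ hcont.continuousOn
  have hs := Set.mem_image_of_mem (fun u : ℝ => (u : ℂ) * x) (Set.left_mem_Icc.2 hst)
  have ht := Set.mem_image_of_mem (fun u : ℝ => (u : ℂ) * x) (Set.right_mem_Icc.2 hst)
  obtain ⟨_, ⟨u, hu, rfl⟩, hu'⟩ : ∃ z ∈ (fun u : ℝ => (u : ℂ) * x) '' Set.Icc s t,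
      z ∈ frontier T := by
    rcases hx with h | h
    · exact hpre.exists_mem_frontier hs h.1 ht h.2
    · exact hpre.exists_mem_frontier ht h.2 hs h.1
  exact ⟨u, hu, hfr hu'⟩

theorem frontier_subset_of_mem_nhds (hT : IsClosed T) (hop : ∀ w ∈ T, w ∉ C → T ∈ 𝓝 w) :
    frontier T ⊆ C := by
  intro w hw
  rw [hT.frontier_eq] at hw
  by_contra hC
  exact hw.2 (mem_interior_iff_mem_nhds.2 (hop w hw.1 hC))

/-- A ray from the origin that has left `T` does not come back: it would cross `C` once when leaving
and once when returning. -/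
theorem mul_notMem_of_one_le (hop : ∀ w ∈ T, w ∉ C → T ∈ 𝓝 w) (hT : IsClosed T) (hCT : C ⊆ T)
    (h0 : (0 : ℂ) ∈ T) (h0C : (0 : ℂ) ∉ C)
    (hray : ∀ w ∈ C, ∀ t : ℝ, 0 < t → (t : ℂ) * w ∈ C → (t : ℂ) * w = w) {w : ℂ} (hw : w ∉ T)
    {t : ℝ} (ht : 1 ≤ t) : (t : ℂ) * w ∉ T := by
  intro htw
  have hfr := frontier_subset_of_mem_nhds hT hop
  have hw0 : w ≠ 0 := by rintro rfl; exact hw h0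
  obtain ⟨a, ha, haC⟩ := exists_mem_of_segment (x := w) hfr zero_le_one
    (Or.inl ⟨by simpa using h0, by simpa using hw⟩)
  obtain ⟨b, hb, hbC⟩ := exists_mem_of_segment (x := w) hfr ht
    (Or.inr ⟨by simpa using hw, htw⟩)
  have ha0 : 0 < a := lt_of_le_of_ne ha.1 fun h => h0C (by simpa [← h] using haC)
  have hb0 : 0 < b := zero_lt_one.trans_le hb.1
  have ha0' : (a : ℂ) ≠ 0 := by exact_mod_cast ha0.ne'
  have hab : ((b / a : ℝ) : ℂ) * (a * w) = b * w := by push_cast; field_simp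
  have h1 := hray _ haC (b / a) (by positivity) (by rwa [hab])
  rw [hab] at h1
  have hba : b = a := by exact_mod_cast mul_right_cancel₀ hw0 h1
  have : a = 1 := le_antisymm ha.2 (hba ▸ hb.1)
  rw [this] at haC
  exact hw (hCT (by simpa using haC))

theorem regionBoundedBy_eq (hop : ∀ w ∈ T, w ∉ C → T ∈ 𝓝 w) (hT : IsCompact T) (hCT : C ⊆ T)
    (h0 : (0 : ℂ) ∈ T) (h0C : (0 : ℂ) ∉ C)
    (hray : ∀ w ∈ C, ∀ t : ℝ, 0 < t → (t : ℂ) * w ∈ C → (t : ℂ) * w = w) :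
    regionBoundedBy C = T := by
  ext w
  constructor
  · rintro (hw | ⟨hwC, hb⟩)
    · exact hCT hw
    · by_contra hwT
      have hw0 : w ≠ 0 := by rintro rfl; exact hwT h0
      -- The ray from `w` away from the origin is unbounded and lies in the component of `w`.
      have hsub : (fun t : ℝ => (t : ℂ) * w) '' Set.Ici 1 ⊆ connectedComponentIn Cᶜ w := by
        refine (isPreconnected_Ici.image _ (by fun_prop)).subset_connectedComponentIn
          ⟨1, Set.self_mem_Ici, by simp⟩ ?_
        rintro _ ⟨t, ht, rfl⟩ htC
        exact mul_notMem_of_one_le hop hT.isClosed hCT h0 h0C hray hwT ht (hCT htC)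
      obtain ⟨R, hR⟩ := (hb.subset hsub).exists_norm_le
      have hwn : 0 < ‖w‖ := norm_pos_iff.2 hw0
      have hR1 := hR _ ⟨max 1 ((R + 1) / ‖w‖), Set.mem_Ici.2 (le_max_left _ _), rfl⟩
      have h2 : (R + 1) / ‖w‖ ≤ max 1 ((R + 1) / ‖w‖) := le_max_right _ _
      rw [norm_mul, Complex.norm_of_nonneg (zero_le_one.trans (le_max_left _ _))] at hR1
      rw [div_le_iff₀ hwn] at h2
      linarith
  · intro hw
    by_cases hwC : w ∈ C
    · exact Or.inl hwC
    -- The component of `w` avoids `C`, hence the frontier of `T`, so it stays inside `T`.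
    refine Or.inr ⟨hwC, hT.isBounded.subset ?_⟩
    have hfr := frontier_subset_of_mem_nhds hT.isClosed hop
    by_contra hnot
    obtain ⟨x, hx, hxT⟩ := Set.not_subset.1 hnot
    obtain ⟨y, hy, hyfr⟩ := (isPreconnected_connectedComponentIn (F := Cᶜ)).exists_mem_frontier
      (mem_connectedComponentIn hwC) hw hx hxT
    exact connectedComponentIn_subset _ _ hy (hfr hyfr)

/-- A point of `C` interior to `T` would have a second point of `C` further out on its ray, where the
ray leaves the bounded set `T`. -/
theorem frontier_eq_of_ray (hop : ∀ w ∈ T, w ∉ C → T ∈ 𝓝 w) (hT : IsCompact T) (hCT : C ⊆ T)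
    (h0C : (0 : ℂ) ∉ C)
    (hray : ∀ w ∈ C, ∀ t : ℝ, 0 < t → (t : ℂ) * w ∈ C → (t : ℂ) * w = w) :
    frontier T = C := by
  have hfr := frontier_subset_of_mem_nhds hT.isClosed hop
  refine hfr.antisymm fun w hw => ?_
  have hw0 : w ≠ 0 := by rintro rfl; exact h0C hw
  rw [hT.isClosed.frontier_eq]
  refine ⟨hCT hw, fun hint => ?_⟩
  have hwn : 0 < ‖w‖ := norm_pos_iff.2 hw0
  obtain ⟨a, ha, haT⟩ : ∃ a : ℝ, 1 < a ∧ (a : ℂ) * w ∈ T := by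
    have hcont : Tendsto (fun t : ℝ => (t : ℂ) * w) (𝓝[>] 1) (𝓝 w) := by
      have : Continuous fun t : ℝ => (t : ℂ) * w := by fun_prop
      simpa using (this.tendsto 1).mono_left nhdsWithin_le_nhds
    exact (eventually_mem_nhdsWithin.and
      (hcont.eventually (mem_interior_iff_mem_nhds.1 hint))).exists
  obtain ⟨R, hR⟩ := hT.isBounded.exists_norm_le
  obtain ⟨b, hab, hbT⟩ : ∃ b : ℝ, a ≤ b ∧ (b : ℂ) * w ∉ T := by
    refine ⟨max a ((R + 1) / ‖w‖), le_max_left _ _, fun hmem => ?_⟩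
    have h1 := hR _ hmem
    have h2 : (R + 1) / ‖w‖ ≤ max a ((R + 1) / ‖w‖) := le_max_right _ _
    rw [norm_mul, Complex.norm_of_nonneg ((zero_le_one.trans ha.le).trans (le_max_left _ _))] at h1
    rw [div_le_iff₀ hwn] at h2
    linarith
  obtain ⟨u, hu, huC⟩ := exists_mem_of_segment hfr hab (Or.inl ⟨haT, hbT⟩)
  have hu1 : 1 < u := ha.trans_le hu.1
  have h1 := hray w hw u (by linarith) huC
  have : (u : ℂ) = 1 := mul_right_cancel₀ hw0 (h1.trans (one_mul w).symm)
  exact hu1.ne' (by exact_mod_cast this)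

end Rays

/-! ### The hypocycloid region -/

/-- The `r`-th roots of unity have sum zero and, for odd `r`, product one. -/
theorem zero_mem_unitSums {r : ℕ} (hr : 1 < r) (hodd : Odd r) : (0 : ℂ) ∈ unitSums r := by
  have hζ := Complex.isPrimitiveRoot_exp r (by omega)
  set ζ := Complex.exp (2 * Real.pi * Complex.I / r)
  refine ⟨(Multiset.range r).map fun i => ζ ^ i, by simp, ?_, ?_, ?_⟩
  · intro z hz
    obtain ⟨i, -, rfl⟩ := Multiset.mem_map.1 hz
    rw [norm_pow, hζ.norm'_eq_one (by omega), one_pow]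
  · change ∏ i ∈ Finset.range r, ζ ^ i = 1
    rw [Finset.prod_pow_eq_pow_sum, Finset.sum_range_id]
    obtain ⟨k, rfl⟩ := hodd
    have : (2 * k + 1) * (2 * k + 1 - 1) / 2 = (2 * k + 1) * k := by
      rw [Nat.add_sub_cancel, mul_left_comm, Nat.mul_div_cancel_left _ two_pos]
    rw [this, pow_mul, hζ.pow_eq_one, one_pow]
  · exact hζ.geom_sum_eq_zero hr

theorem mainTheorem3 (r : ℕ) (hr : Nat.Prime r) (hodd : Odd r) :
    (∀ z : Fin (Nat.totient r) → Circle,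
      gFun r z = (∑ j, (z j : ℂ)) + 1 / ∏ j, (z j : ℂ)) ∧
    (IsCompact (hypocycloidRegion r) ∧
      frontier (hypocycloidRegion r) = Set.range (hypocycloid r)) ∧
    Set.range (gFun r) = hypocycloidRegion r ∧
    {w : ℂ | ∃ A ∈ Matrix.specialUnitaryGroup (Fin r) ℂ, A.trace = w} = hypocycloidRegion r := by
  obtain ⟨n, rfl⟩ : ∃ n, r = n + 1 := ⟨r - 1, (Nat.sub_add_cancel hr.one_le).symm⟩
  have hn : 2 ≤ n := by
    have := hr.two_le
    obtain ⟨k, hk⟩ := hodd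
    omega
  have hop : ∀ w ∈ unitSums (n + 1), w ∉ Set.range (hypocycloid (n + 1)) →
      unitSums (n + 1) ∈ 𝓝 w := fun w hw => unitSums_mem_nhds hw
  have hT := isCompact_unitSums_succ n
  have hCT : Set.range (hypocycloid (n + 1)) ⊆ unitSums (n + 1) :=
    Set.range_subset_iff.2 (hypocycloid_mem_unitSums n)
  have h0C : (0 : ℂ) ∉ Set.range (hypocycloid (n + 1)) := by
    rintro ⟨θ, hθ⟩
    exact hypocycloid_ne_zero hn θ hθ
  have hray : ∀ w ∈ Set.range (hypocycloid (n + 1)), ∀ t : ℝ, 0 < t →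
      (t : ℂ) * w ∈ Set.range (hypocycloid (n + 1)) → (t : ℂ) * w = w := by
    rintro _ ⟨θ, rfl⟩ t ht ⟨θ', h⟩
    rw [← h, hypocycloid_eq_of_ray hn ht h]
  have hH : hypocycloidRegion (n + 1) = unitSums (n + 1) :=
    regionBoundedBy_eq hop hT hCT (zero_mem_unitSums hr.one_lt hodd) h0C hray
  rw [hH]
  exact ⟨gFun_prime hr, ⟨hT, frontier_eq_of_ray hop hT hCT h0C hray⟩, range_gFun hr,
    traces_specialUnitaryGroup _⟩
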